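/- Theorem. All graphs are finite, simple and without isolated vertices. For graphs $G, G_1, G_2$ write $G \to (G_1,G_2)$ if for every partition $(E_1,E_2)$ of $E(G)$, either $G_1$ is isomorphic to a (not necessarily induced) subgraph of the graph induced by $E_1$, or $G_2$ is isomorphic to a subgraph of the graph induced by $E_2$. The size Ramsey number $\hat r(G_1,G_2)$ is the smallest positive integer $m$ for which there is a graph $G$ with exactly $m$ edges such that $G \to (G_1,G_2)$. Let $P_3$ be the path on three vertices, and let $F_n$ be the fan $K_1+nK_2$, obtained from $n$ pairwise disjoint edges by adding one new vertex and joining it to all of their $2n$ endpoints. Then for every positive integer $n$, $$\hat r(P_3,F_n)=\begin{cases}10, & \text{if } n=2;\\ 4n+4, & \text{if } n \text{ is odd};\\ 4n+5, & \text{if } n \text{ is even and } n\neq 2.\end{cases}$$ -/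

import Mathlib

/-- `Arrows G G₁ G₂` is `G → (G₁, G₂)`: whenever the edges of `G` are partitioned into the edges of a
red graph `R` and a blue graph `B`, there is a copy of `G₁` in `R` or a copy of `G₂` in `B` (`H ⊑ G`
means that `G` has a not necessarily induced subgraph isomorphic to `H`). -/
def Arrows {V V₁ V₂ : Type*} (G : SimpleGraph V) (G₁ : SimpleGraph V₁) (G₂ : SimpleGraph V₂) :
    Prop :=
  ∀ R B : SimpleGraph V, R ⊔ B = G → Disjoint R B → G₁.IsContained R ∨ G₂.IsContained B

/-- The positive integers `m` for which some finite simple graph `G` without isolated vertices has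
exactly `m` edges and satisfies `G → (G₁, G₂)`. -/
def arrowingSizes {V₁ V₂ : Type*} (G₁ : SimpleGraph V₁) (G₂ : SimpleGraph V₂) : Set ℕ :=
  {m | 0 < m ∧ ∃ (k : ℕ) (G : SimpleGraph (Fin k)),
    (∀ v, ∃ w, G.Adj v w) ∧ G.edgeSet.ncard = m ∧ Arrows G G₁ G₂}

/-- `IsSizeRamseyNumber G₁ G₂ m` says that the size Ramsey number of `(G₁, G₂)` is `m`: the least
positive integer that is the number of edges of a graph `G` with `G → (G₁, G₂)`. -/
def IsSizeRamseyNumber {V₁ V₂ : Type*} (G₁ : SimpleGraph V₁) (G₂ : SimpleGraph V₂) (m : ℕ) :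
    Prop :=
  IsLeast (arrowingSizes G₁ G₂) m

/-- The fan `F_n = K₁ + n K₂`: the center `none` is joined to all the vertices `some (i, b)`, and
for each `i` the two vertices `some (i, false)` and `some (i, true)` are adjacent. -/
def fan (n : ℕ) : SimpleGraph (Option (Fin n × Bool)) where
  Adj
    | none, none => False
    | none, some _ => True
    | some _, none => True
    | some (i, b), some (j, c) => i = j ∧ b ≠ c
  symm := ⟨by
    rintro (_ | ⟨i, b⟩) (_ | ⟨j, c⟩) h
    · exact h
    · trivial
    · trivial
    · exact ⟨h.1.symm, h.2.symm⟩⟩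
  loopless := ⟨by
    rintro (_ | ⟨i, b⟩) h
    · exact h
    · exact h.2 rfl⟩

/-! A red graph without a path on three vertices is a matching, so the arrow relation says that a
copy of `fan n` survives the deletion of any matching (`FanRobust`). A fan centre must have degree
at least 2n, and the lower bound splits by the number of such vertices. Edges are counted through
`darts`, which is twice their number.

With one candidate centre u, let S be its neighbourhood. The matching may contain a spoke uv, so for
every v the set S - v must still contain n disjoint edges after the deletion of any matching. The
cost |S| + e(S) is at most the number of edges of the graph. Removing vertices of degree 0 or 1 by
induction shows that the cost is at least 4n + 4 (`regular_of_erase_robust`), with equality only if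
S is 2-regular on 2n + 2 vertices. For n ≥ 4, equality moreover forces every component to be a
4-cycle (`four_dvd_card_of_erase_robust`). Then 4 divides 2n + 2, so n is odd; this is the extra
edge for even n.

With several candidate centres there are at least 6n - 2 edges, which suffices for n ≥ 2 and is
exactly 10 at n = 2. For n = 1 the fan is a triangle, and a separate count gives 8 edges.

The bounds are attained by cones: a 4-cycle minus a matching keeps two disjoint edges at a cost of
8, and a three-vertex path keeps one at a cost of 5. Only n = 2 has a cheaper host, the complete
graph on five vertices. -/

namespace FanRamsey

/-! ### Matchings that survive the deletion of a matching -/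

variable {V : Type*}

/-- A graph whose edges form a matching. -/
def IsMatchingGraph (R : SimpleGraph V) : Prop :=
  ∀ ⦃x a b⦄, R.Adj x a → R.Adj x b → a = b

/-- `S` contains a set of at least `m` vertices that is perfectly matched by edges of `B`. -/
def Matchable (B : SimpleGraph V) (S : Finset V) (m : ℕ) : Prop :=
  ∃ T ⊆ S, m ≤ T.card ∧ ∃ σ : V → V, ∀ x ∈ T, σ x ∈ T ∧ B.Adj x (σ x) ∧ σ (σ x) = x

/-- After the deletion of any matching, at least `m` vertices of `S` can be matched within `S`. -/
def Robust (G : SimpleGraph V) (S : Finset V) (m : ℕ) : Prop :=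
  ∀ R, IsMatchingGraph R → Matchable (G \ R) S m

/-- The matching graph obtained from `R` by deleting all edges at `x` and `y` and joining `x`
to `y`. -/
def pairUp (R : SimpleGraph V) (x y : V) : SimpleGraph V where
  Adj a b := a ≠ b ∧ ((a = x ∧ b = y) ∨ (a = y ∧ b = x) ∨
    (a ≠ x ∧ a ≠ y ∧ b ≠ x ∧ b ≠ y ∧ R.Adj a b))
  symm := ⟨by
    intro a b h
    have := R.adj_comm a b
    tauto⟩
  loopless := ⟨fun a h => h.1 rfl⟩

lemma isMatchingGraph_bot : IsMatchingGraph (⊥ : SimpleGraph V) := fun _ _ _ h => h.elim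

lemma IsMatchingGraph.pairUp {R : SimpleGraph V} (hR : IsMatchingGraph R) (x y : V) :
    IsMatchingGraph (pairUp R x y) := by
  intro z a b ha hb
  have := @hR z a b
  simp only [FanRamsey.pairUp] at ha hb
  grind

lemma pairUp_adj_self {R : SimpleGraph V} {x y : V} (h : x ≠ y) : (pairUp R x y).Adj x y :=
  ⟨h, Or.inl ⟨rfl, rfl⟩⟩

lemma pairUp_adj_of_ne {R : SimpleGraph V} {x y a b : V} (hax : a ≠ x) (hay : a ≠ y) (hbx : b ≠ x)
    (hby : b ≠ y) : (pairUp R x y).Adj a b ↔ R.Adj a b := by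
  simp only [pairUp]
  constructor
  · tauto
  · exact fun h => ⟨h.ne, by tauto⟩

lemma Matchable.le_card {B : SimpleGraph V} {S : Finset V} {m : ℕ} (h : Matchable B S m) :
    m ≤ S.card := by
  obtain ⟨T, hT, hm, -⟩ := h
  exact hm.trans (Finset.card_le_card hT)

lemma Matchable.mono {B B' : SimpleGraph V} {S S' : Finset V} {m : ℕ} (h : Matchable B S m)
    (hS : S ⊆ S') (hB : ∀ a ∈ S, ∀ b ∈ S, B.Adj a b → B'.Adj a b) : Matchable B' S' m := by
  obtain ⟨T, hT, hm, σ, hσ⟩ := h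
  exact ⟨T, hT.trans hS, hm, σ, fun x hx =>
    ⟨(hσ x hx).1, hB _ (hT hx) _ (hT (hσ x hx).1) (hσ x hx).2.1, (hσ x hx).2.2⟩⟩

lemma Robust.le_card {G : SimpleGraph V} {S : Finset V} {m : ℕ} (h : Robust G S m) : m ≤ S.card :=
  (h ⊥ isMatchingGraph_bot).le_card

open Classical in
/-- The number of neighbours of `x` in `S`. -/
noncomputable def inDeg (G : SimpleGraph V) (S : Finset V) (x : V) : ℕ :=
  (S.filter fun y => G.Adj x y).card

/-- Twice the number of edges inside `S`. -/
noncomputable def darts (G : SimpleGraph V) (S : Finset V) : ℕ := ∑ x ∈ S, inDeg G S x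

lemma inDeg_eq_zero {G : SimpleGraph V} {S : Finset V} {x : V} (h : inDeg G S x = 0) :
    ∀ y ∈ S, ¬ G.Adj x y := by
  classical
  unfold inDeg at h
  simpa [Finset.filter_eq_empty_iff] using h

lemma inDeg_eq_one {G : SimpleGraph V} {S : Finset V} {x : V} (h : inDeg G S x = 1) :
    ∃ y ∈ S, G.Adj x y ∧ ∀ z ∈ S, G.Adj x z → z = y := by
  classical
  obtain ⟨y, hy⟩ := Finset.card_eq_one.1 h
  simp only [Finset.ext_iff, Finset.mem_filter, Finset.mem_singleton] at hy
  have := (hy y).2 rfl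
  exact ⟨y, this.1, this.2, fun z hz hxz => (hy z).1 ⟨hz, hxz⟩⟩

lemma exists_adj_of_inDeg_ne_zero {G : SimpleGraph V} {S : Finset V} {x : V}
    (h : inDeg G S x ≠ 0) : ∃ y ∈ S, G.Adj x y := by
  classical
  obtain ⟨y, hy⟩ := Finset.card_ne_zero.1 h
  exact ⟨y, (Finset.mem_filter.1 hy).1, (Finset.mem_filter.1 hy).2⟩

lemma card_le_inDeg {G : SimpleGraph V} {S A : Finset V} {x : V} (h : ∀ y ∈ A, y ∈ S ∧ G.Adj x y) :
    A.card ≤ inDeg G S x := by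
  classical
  exact Finset.card_le_card fun y hy => Finset.mem_filter.2 (h y hy)

lemma darts_of_forall {G : SimpleGraph V} {S : Finset V} (h : ∀ x ∈ S, inDeg G S x = 2) :
    darts G S = 2 * S.card := by
  rw [darts, Finset.sum_congr rfl h, Finset.sum_const, smul_eq_mul, mul_comm]

lemma le_darts_of_forall {G : SimpleGraph V} {S : Finset V} (h : ∀ x ∈ S, 2 ≤ inDeg G S x) :
    2 * S.card ≤ darts G S := by
  have := Finset.card_nsmul_le_sum S (fun x => inDeg G S x) 2 h
  rw [smul_eq_mul] at this
  rw [darts]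
  omega

lemma inDeg_eq_two_of_darts_le {G : SimpleGraph V} {S : Finset V} (h : ∀ x ∈ S, 2 ≤ inDeg G S x)
    (hd : darts G S ≤ 2 * S.card) : ∀ x ∈ S, inDeg G S x = 2 := by
  have h2 : ∑ x ∈ S, 2 = ∑ x ∈ S, inDeg G S x := by
    refine le_antisymm (Finset.sum_le_sum h) ?_
    simpa [mul_comm, darts] using hd
  exact fun x hx => ((Finset.sum_eq_sum_iff_of_le h).1 h2 x hx).symm

variable [DecidableEq V]

lemma Matchable.erase_isolated {B : SimpleGraph V} {S : Finset V} {m : ℕ} (h : Matchable B S m)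
    {x : V} (hx : ∀ y ∈ S, ¬ B.Adj x y) : Matchable B (S.erase x) m := by
  obtain ⟨T, hT, hm, σ, hσ⟩ := h
  refine ⟨T, fun z hz => Finset.mem_erase.2 ⟨?_, hT hz⟩, hm, σ, hσ⟩
  rintro rfl
  exact hx _ (hT (hσ z hz).1) (hσ z hz).2.1

/-- Losing a vertex costs at most that vertex and its partner. -/
lemma Matchable.erase {B : SimpleGraph V} {S : Finset V} {m : ℕ} (h : Matchable B S (m + 2))
    (y : V) : Matchable B (S.erase y) m := by
  obtain ⟨T, hT, hm, σ, hσ⟩ := h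
  by_cases hy : y ∈ T
  · refine ⟨(T.erase y).erase (σ y), ?_, ?_, σ, ?_⟩
    · exact (Finset.erase_subset _ _).trans (Finset.erase_subset_erase _ hT)
    · rw [Finset.card_erase_of_mem, Finset.card_erase_of_mem hy]
      · omega
      · exact Finset.mem_erase.2 ⟨(hσ y hy).2.1.ne', (hσ y hy).1⟩
    · intro x hx
      simp only [Finset.mem_erase] at hx ⊢
      have h1 := hσ x hx.2.2
      have h2 := hσ y hy
      refine ⟨⟨?_, ?_, h1.1⟩, h1.2⟩
      · intro h; apply hx.2.1; rw [← h1.2.2, h, h2.2.2]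
      · intro h; apply hx.1; rw [← h1.2.2, h]
  · exact ⟨T, fun z hz => Finset.mem_erase.2 ⟨by rintro rfl; exact hy hz, hT hz⟩, by omega, σ, hσ⟩

lemma Robust.erase {G : SimpleGraph V} {S : Finset V} {m : ℕ} (h : Robust G S (m + 2)) (y : V) :
    Robust G (S.erase y) m := fun R hR => (h R hR).erase y

lemma Robust.erase_isolated {G : SimpleGraph V} {S : Finset V} {m : ℕ} (h : Robust G S m) {x : V}
    (hx : ∀ y ∈ S, ¬ G.Adj x y) : Robust G (S.erase x) m :=
  fun R hR => (h R hR).erase_isolated fun y hy h => hx y hy h.1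

/-- A matching on the rest can be enlarged by the edge xy, which then contributes nothing. -/
lemma Robust.erase_isolated_edge {G : SimpleGraph V} {S : Finset V} {m : ℕ} (h : Robust G S m)
    {x y : V} (hxy : x ≠ y) (hx : ∀ z ∈ S, G.Adj x z → z = y) (hy : ∀ z ∈ S, G.Adj y z → z = x) :
    Robust G ((S.erase x).erase y) m := by
  intro R hR
  refine (((h _ (hR.pairUp x y)).erase_isolated (x := x) ?_).erase_isolated
    (x := y) ?_).mono subset_rfl ?_
  · rintro z hz ⟨h1, h2⟩
    obtain rfl := hx z hz h1
    exact h2 (pairUp_adj_self hxy)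
  · rintro z hz ⟨h1, h2⟩
    have := hy z (Finset.mem_of_mem_erase hz) h1
    simp [this] at hz
  · rintro a ha b hb ⟨h1, h2⟩
    simp only [Finset.mem_erase] at ha hb
    rw [pairUp_adj_of_ne ha.2.1 ha.1 hb.2.1 hb.1] at h2
    exact ⟨h1, h2⟩

open Classical in
lemma inDeg_erase (G : SimpleGraph V) {S : Finset V} {x : V} (hx : x ∈ S) (y : V) :
    inDeg G S y = inDeg G (S.erase x) y + if G.Adj y x then 1 else 0 := by
  unfold inDeg
  rw [Finset.filter_erase]
  split_ifs with h
  · rw [Finset.card_erase_add_one]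
    simp [hx, h]
  · rw [Finset.erase_eq_of_notMem]
    · rfl
    · simp [h]

lemma darts_erase (G : SimpleGraph V) {S : Finset V} {x : V} (hx : x ∈ S) :
    darts G S = darts G (S.erase x) + 2 * inDeg G S x := by
  classical
  unfold darts
  rw [← Finset.add_sum_erase S _ hx,
    Finset.sum_congr rfl fun y _ => inDeg_erase G hx y, Finset.sum_add_distrib]
  have : ∑ y ∈ S.erase x, (if G.Adj y x then 1 else 0) = inDeg G S x := by
    rw [inDeg_erase G hx x, inDeg, Finset.card_filter]
    simp [G.adj_comm]
  omega

lemma inDeg_eq_two {G : SimpleGraph V} {S : Finset V} {x a : V} (h : inDeg G S x = 2) (ha : a ∈ S)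
    (hxa : G.Adj x a) :
    ∃ b ∈ S, b ≠ a ∧ G.Adj x b ∧ ∀ z ∈ S, G.Adj x z → z = a ∨ z = b := by
  classical
  have h1 := inDeg_erase G ha x
  rw [if_pos hxa, h] at h1
  obtain ⟨b, hb, hxb, hz⟩ := inDeg_eq_one (G := G) (S := S.erase a) (x := x) (by omega)
  simp only [Finset.mem_erase] at hb hz
  refine ⟨b, hb.2, hb.1, hxb, fun z hzS hxz => ?_⟩
  by_cases hza : z = a
  · exact Or.inl hza
  · exact Or.inr (hz z ⟨hza, hzS⟩ hxz)

/-! ### Cost of a robust set -/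

/-- A set in which `2 * n` vertices can always be matched after the deletion of a matching has
vertices and edges totalling at least `4 * n`, and equality forces a spanning `2`-regular graph. -/
theorem Robust.regular {G : SimpleGraph V} (S : Finset V) : ∀ {n : ℕ}, Robust G S (2 * n) →
    2 * S.card + darts G S ≤ 8 * n → S.card = 2 * n ∧ ∀ x ∈ S, inDeg G S x = 2 := by
  induction S using Finset.strongInduction with
  | H S ih =>
  intro n h hc
  by_cases h2 : ∀ x ∈ S, 2 ≤ inDeg G S x
  · have h3 := le_darts_of_forall h2
    have h4 := h.le_card
    exact ⟨by omega, inDeg_eq_two_of_darts_le h2 (by omega)⟩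
  exfalso
  push Not at h2
  obtain ⟨x, hx, hx2⟩ := h2
  have hdx := darts_erase G hx
  have hcx := Finset.card_erase_add_one hx
  obtain h0 | h1 : inDeg G S x = 0 ∨ inDeg G S x = 1 := by omega
  -- The smaller set would already have cost exactly `8 * n`, leaving no room for `x`.
  · have := ih _ (Finset.erase_ssubset hx) (h.erase_isolated (inDeg_eq_zero h0)) (by omega)
    have := darts_of_forall this.2
    omega
  obtain ⟨y, hy, hxy, hxu⟩ := inDeg_eq_one h1
  have hyx : y ∈ S.erase x := Finset.mem_erase.2 ⟨hxy.ne', hy⟩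
  have hdy := darts_erase G hyx
  have hcy := Finset.card_erase_add_one hyx
  have hdeg := inDeg_erase G hx y
  rw [if_pos hxy.symm] at hdeg
  have hss : (S.erase x).erase y ⊂ S :=
    (Finset.erase_subset _ _).trans_ssubset (Finset.erase_ssubset hx)
  by_cases hy1 : inDeg G (S.erase x) y = 0
  · obtain ⟨z, -, -, hyu⟩ := inDeg_eq_one (hdeg.trans (by rw [hy1]))
    have hyu' : ∀ w ∈ S, G.Adj y w → w = x := fun w hw h =>
      (hyu w hw h).trans (hyu x hx hxy.symm).symm
    have := ih _ hss (h.erase_isolated_edge hxy.ne hxu hyu') (by omega)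
    have := darts_of_forall this.2
    omega
  -- Removing `x` and `y` lowers the cost by at least 8, so induction leaves exactly `2 * k`
  -- vertices. But deleting the pendant edge `xy` isolates `x`, and the `2 * k + 1` remaining
  -- vertices are too few.
  · obtain ⟨k, rfl⟩ : ∃ k, n = k + 1 := ⟨n - 1, by omega⟩
    have hr : Robust G ((S.erase x).erase y) (2 * k) := by
      rw [Finset.erase_right_comm]
      refine (Robust.erase h y).erase_isolated fun z hz hxz => ?_
      exact (Finset.mem_erase.1 hz).1 (hxu z (Finset.mem_of_mem_erase hz) hxz)
    have hk := (ih _ hss hr (by omega)).1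
    have := (h _ (isMatchingGraph_bot.pairUp x y)).erase_isolated (x := x) (by
      rintro z hz ⟨h1, h2⟩
      obtain rfl := hxu z hz h1
      exact h2 (pairUp_adj_self hxy.ne))
    have := this.le_card
    omega

end FanRamsey

/-! ### Neighbourhoods of a single centre: the extremal structure -/

namespace FanRamsey

variable {V : Type*}

lemma Matchable.perfect {B : SimpleGraph V} {S : Finset V} {m : ℕ} (h : Matchable B S m)
    (hm : S.card ≤ m) : ∃ σ : V → V, ∀ x ∈ S, σ x ∈ S ∧ B.Adj x (σ x) ∧ σ (σ x) = x := by
  obtain ⟨T, hTS, hT, σ, hσ⟩ := h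
  obtain rfl := Finset.eq_of_subset_of_card_le hTS (hm.trans hT)
  exact ⟨σ, hσ⟩

lemma Matchable.false_of_triangle {B : SimpleGraph V} {S : Finset V} {m : ℕ} (h : Matchable B S m)
    (hm : S.card ≤ m) {x a b : V} (hx : x ∈ S) (ha : a ∈ S) (hb : b ∈ S)
    (hxn : ∀ z ∈ S, B.Adj x z → z = a ∨ z = b) (han : ∀ z ∈ S, B.Adj a z → z = x ∨ z = b)
    (hbn : ∀ z ∈ S, B.Adj b z → z = x ∨ z = a) (hxa : x ≠ a) (hxb : x ≠ b) (hab : a ≠ b) :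
    False := by
  obtain ⟨σ, hσ⟩ := h.perfect hm
  have h1 := hxn _ (hσ x hx).1 (hσ x hx).2.1
  have h2 := han _ (hσ a ha).1 (hσ a ha).2.1
  have h3 := hbn _ (hσ b hb).1 (hσ b hb).2.1
  have e1 := (hσ x hx).2.2
  have e2 := (hσ a ha).2.2
  have e3 := (hσ b hb).2.2
  grind

lemma Matchable.false_of_cherry {B : SimpleGraph V} {S : Finset V} {m : ℕ} (h : Matchable B S m)
    (hm : S.card ≤ m) {x a b : V} (ha : a ∈ S) (hb : b ∈ S) (hab : a ≠ b)
    (han : ∀ z ∈ S, B.Adj a z → z = x) (hbn : ∀ z ∈ S, B.Adj b z → z = x) : False := by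
  obtain ⟨σ, hσ⟩ := h.perfect hm
  apply hab
  rw [← (hσ a ha).2.2, ← (hσ b hb).2.2, han _ (hσ a ha).1 (hσ a ha).2.1,
    hbn _ (hσ b hb).1 (hσ b hb).2.1]

variable [DecidableEq V]

lemma eq_or_eq_of_inDeg_eq_two {G : SimpleGraph V} {S : Finset V} {x a b : V}
    (h : inDeg G S x = 2) (ha : a ∈ S) (hxa : G.Adj x a) (hb : b ∈ S) (hxb : G.Adj x b)
    (hab : a ≠ b) : ∀ z ∈ S, G.Adj x z → z = a ∨ z = b := by
  obtain ⟨c, -, -, -, hc⟩ := inDeg_eq_two h ha hxa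
  intro z hz hxz
  have := hc b hb hxb
  have := hc z hz hxz
  grind

/-- Removing a vertex v of degree at least 3 saves at least 8, so S - v is extremal: 2-regular on `2
* n` vertices, and v has degree exactly 3. Neighbours of v then have degree 3 too, and comparing S -
v with S - x shows that adjacency to v spreads along a cycle of S - v. That cycle is not a triangle,
as S - v must be perfectly matched, so v has at least four neighbours. -/
lemma inDeg_le_two_of_erase_robust {G : SimpleGraph V} {S : Finset V} {n : ℕ}
    (h : ∀ v, Robust G (S.erase v) (2 * n)) (hc : 2 * S.card + darts G S ≤ 8 * n + 8) : ∀ x ∈ S, inDeg G S x ≤ 2 := by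
  have key : ∀ v ∈ S, 3 ≤ inDeg G S v → inDeg G S v = 3 ∧ (S.erase v).card = 2 * n ∧
      ∀ x ∈ S.erase v, inDeg G (S.erase v) x = 2 := by
    intro v hv h3
    have hd := darts_erase G hv
    have hcard := Finset.card_erase_add_one hv
    have := (h v).regular _ (by omega)
    have := darts_of_forall this.2
    exact ⟨by omega, ‹_›⟩
  intro v hv
  by_contra! h3
  obtain ⟨hv3, hvc, hvr⟩ := key v hv h3
  have deg3 : ∀ x ∈ S, G.Adj v x → inDeg G S x = 3 := by
    intro x hx hvx
    rw [inDeg_erase G hv, hvr x (Finset.mem_erase.2 ⟨hvx.ne', hx⟩), if_pos hvx.symm]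
  have closed : ∀ x ∈ S, G.Adj v x → ∀ a ∈ S, a ≠ v → G.Adj x a → G.Adj v a := by
    intro x hx hvx a ha hav hxa
    have h1 := (key x hx (deg3 x hx hvx).ge).2.2 a (Finset.mem_erase.2 ⟨hxa.ne', ha⟩)
    have h2 := inDeg_erase G hx a
    rw [h1, if_pos hxa.symm] at h2
    have h4 := inDeg_erase G hv a
    rw [hvr a (Finset.mem_erase.2 ⟨hav, ha⟩), h2] at h4
    by_contra hva
    rw [if_neg fun h => hva h.symm] at h4
    omega
  obtain ⟨x, hx, hvx⟩ := exists_adj_of_inDeg_ne_zero (G := G) (S := S) (x := v) (by omega)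
  have hxv : x ∈ S.erase v := Finset.mem_erase.2 ⟨hvx.ne', hx⟩
  obtain ⟨a, ha, hxa⟩ := exists_adj_of_inDeg_ne_zero (G := G) (S := S.erase v) (x := x)
    (by rw [hvr x hxv]; omega)
  obtain ⟨b, hb, hba, hxb, -⟩ := inDeg_eq_two (hvr x hxv) ha hxa
  obtain ⟨y, hy, hyx, hay, -⟩ := inDeg_eq_two (hvr a ha) hxv hxa.symm
  have hnab : ¬ G.Adj a b := by
    intro hab
    refine (h v _ isMatchingGraph_bot).false_of_triangle hvc.le hxv ha hb ?_ ?_ ?_ hxa.ne hxb.ne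
      hba.symm
    · exact fun z hz hz' => eq_or_eq_of_inDeg_eq_two (hvr x hxv) ha hxa hb hxb hba.symm z hz hz'.1
    · exact fun z hz hz' =>
        eq_or_eq_of_inDeg_eq_two (hvr a ha) hxv hxa.symm hb hab hxb.ne z hz hz'.1
    · exact fun z hz hz' =>
        eq_or_eq_of_inDeg_eq_two (hvr b hb) hxv hxb.symm ha hab.symm hxa.ne z hz hz'.1
  simp only [Finset.mem_erase] at ha hb hy
  have hva := closed x hx hvx a ha.2 ha.1 hxa
  have hvb := closed x hx hvx b hb.2 hb.1 hxb
  have hvy := closed a ha.2 hva y hy.2 hy.1 hay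
  have hby : b ≠ y := by rintro rfl; exact hnab hay
  have h4 := card_le_inDeg (G := G) (S := S) (A := {x, a, b, y}) (x := v) (by
    simp only [Finset.mem_insert, Finset.mem_singleton]
    rintro z (rfl | rfl | rfl | rfl)
    exacts [⟨hx, hvx⟩, ⟨ha.2, hva⟩, ⟨hb.2, hvb⟩, ⟨hy.2, hvy⟩])
  have : ({x, a, b, y} : Finset V).card = 4 := by
    simp [Finset.card_insert_of_notMem, hxa.ne, hxb.ne, hay.ne, hby, hba.symm, hyx.symm]
  omega

/-- If `2 * n` vertices of `S` can be matched after the deletion of any vertex and any matching,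
then `S` has vertices and edges totalling at least `4 * n + 4`, with equality only for `2`-regular
graphs. -/
theorem regular_of_erase_robust [Nonempty V] {G : SimpleGraph V} {n : ℕ} (hn : 0 < n)
    (S : Finset V) : (∀ v, Robust G (S.erase v) (2 * n)) →
    2 * S.card + darts G S ≤ 8 * n + 8 → S.card = 2 * n + 2 ∧ ∀ x ∈ S, inDeg G S x = 2 := by
  induction S using Finset.strongInduction with
  | H S ih =>
  intro h hc
  by_cases hmin : ∀ x ∈ S, 2 ≤ inDeg G S x
  · have hreg : ∀ x ∈ S, inDeg G S x = 2 := fun x hx =>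
      le_antisymm (inDeg_le_two_of_erase_robust h hc x hx) (hmin x hx)
    refine ⟨?_, hreg⟩
    have hd := darts_of_forall hreg
    obtain ⟨v, hv⟩ : S.Nonempty := by
      obtain ⟨v⟩ := ‹Nonempty V›
      have h1 := (h v).le_card
      have h2 := Finset.card_le_card (Finset.erase_subset v S)
      exact Finset.card_pos.1 (by omega)
    have hcard := Finset.card_erase_add_one hv
    have h1 := (h v).le_card
    by_contra hne
    -- Erasing `v` and deleting the other edge `wu` at `w` isolates `w`, so two vertices are lost
    -- and `2 * n` must remain.
    obtain ⟨w, hw, hvw⟩ := exists_adj_of_inDeg_ne_zero (G := G) (S := S) (x := v)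
      (by rw [hreg v hv]; omega)
    obtain ⟨u, hu, huv, hwu, hwn⟩ := inDeg_eq_two (hreg w hw) hv hvw.symm
    have h3 := ((h v) _ (isMatchingGraph_bot.pairUp w u)).erase_isolated (x := w) (by
      rintro z hz ⟨h2, h3⟩
      obtain rfl | rfl := hwn z (Finset.mem_of_mem_erase hz) h2
      · simp at hz
      · exact h3 (pairUp_adj_self h2.ne))
    have h4 := h3.le_card
    have := Finset.card_erase_add_one (Finset.mem_erase.2 ⟨hvw.ne', hw⟩ : w ∈ S.erase v)
    omega
  exfalso
  push Not at hmin
  obtain ⟨x, hx, hx2⟩ := hmin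
  have hdx := darts_erase G hx
  have hcx := Finset.card_erase_add_one hx
  obtain h0 | h1 : inDeg G S x = 0 ∨ inDeg G S x = 1 := by omega
  · have := ih _ (Finset.erase_ssubset hx) (fun v => by
      rw [Finset.erase_right_comm]
      exact (h v).erase_isolated fun y hy => inDeg_eq_zero h0 y (Finset.mem_of_mem_erase hy))
      (by omega)
    have := darts_of_forall this.2
    omega
  obtain ⟨y, hy, hxy, hxu⟩ := inDeg_eq_one h1
  have hyx : y ∈ S.erase x := Finset.mem_erase.2 ⟨hxy.ne', hy⟩
  have hdy := darts_erase G hyx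
  have hcy := Finset.card_erase_add_one hyx
  have hdeg := inDeg_erase G hx y
  rw [if_pos hxy.symm] at hdeg
  have hss : (S.erase x).erase y ⊂ S :=
    (Finset.erase_subset _ _).trans_ssubset (Finset.erase_ssubset hx)
  by_cases hy1 : inDeg G (S.erase x) y = 0
  · obtain ⟨z, -, -, hyu⟩ := inDeg_eq_one (hdeg.trans (by rw [hy1]))
    have hyu' : ∀ w ∈ S, G.Adj y w → w = x := fun w hw h =>
      (hyu w hw h).trans (hyu x hx hxy.symm).symm
    have := ih _ hss (fun v => by
      rw [Finset.erase_right_comm, Finset.erase_right_comm (a := x)]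
      exact (h v).erase_isolated_edge hxy.ne (fun z hz => hxu z (Finset.mem_of_mem_erase hz))
        (fun z hz => hyu' z (Finset.mem_of_mem_erase hz))) (by omega)
    have := darts_of_forall this.2
    omega
  -- Erasing `y` isolates `x`, so the rest is extremal and 2-regular. Another neighbour `z` of `y`
  -- then has degree at least 3 in `S`, so `S.erase z` is extremal as well, yet the pendant vertex
  -- `x` has degree at most 1 there.
  · have hr : Robust G ((S.erase x).erase y) (2 * n) := by
      rw [Finset.erase_right_comm]
      refine (h y).erase_isolated fun z hz hxz => ?_
      exact (Finset.mem_erase.1 hz).1 (hxu z (Finset.mem_of_mem_erase hz) hxz)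
    obtain ⟨z, hz, hyz⟩ := exists_adj_of_inDeg_ne_zero hy1
    have hzx := Finset.mem_erase.1 hz
    have hreg := (hr.regular _ (by omega)).2 z (Finset.mem_erase.2 ⟨hyz.ne', hz⟩)
    have hz2 := inDeg_erase G hyx z
    have hz3 := inDeg_erase G hx z
    rw [if_pos hyz.symm] at hz2
    have hdz := darts_erase G hzx.2
    have hcz := Finset.card_erase_add_one hzx.2
    have hxz := ((h z).regular _ (by omega)).2 x (Finset.mem_erase.2 ⟨hzx.1.symm, hx⟩)
    have := inDeg_erase G hzx.2 x
    omega

/-- Erasing v and deleting wu isolates w. In the extremal case exactly m vertices remain, so they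
must be perfectly matched, whatever else is deleted away from w and u. -/
lemma matchable_erase_erase {G R : SimpleGraph V} {S : Finset V} {m : ℕ}
    (h : ∀ v, Robust G (S.erase v) m) (hR : IsMatchingGraph R) {u v w : V}
    (hw : ∀ z ∈ S, G.Adj w z → z = v ∨ z = u) :
    Matchable (G \ pairUp R w u) ((S.erase v).erase w) m := by
  refine (h v _ (hR.pairUp w u)).erase_isolated ?_
  rintro z hz ⟨h2, h3⟩
  obtain rfl | rfl := hw z (Finset.mem_of_mem_erase hz) h2
  · simp at hz
  · exact h3 (pairUp_adj_self h2.ne)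

/-- A triangle would be a whole component. Spending the two losses on a different component leaves
this odd component to be perfectly matched. -/
lemma not_adj_of_erase_robust {G : SimpleGraph V} {S : Finset V} {n : ℕ} (hn : 0 < n)
    (h : ∀ v, Robust G (S.erase v) (2 * n)) (hcard : S.card = 2 * n + 2)
    (hreg : ∀ x ∈ S, inDeg G S x = 2) {x a b : V} (hx : x ∈ S) (ha : a ∈ S) (hb : b ∈ S)
    (hxa : G.Adj x a) (hxb : G.Adj x b) (hab : a ≠ b) : ¬ G.Adj a b := by
  intro hadj
  have hxn := eq_or_eq_of_inDeg_eq_two (hreg x hx) ha hxa hb hxb hab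
  have han := eq_or_eq_of_inDeg_eq_two (hreg a ha) hx hxa.symm hb hadj hxb.ne
  have hbn := eq_or_eq_of_inDeg_eq_two (hreg b hb) hx hxb.symm ha hadj.symm hxa.ne
  obtain ⟨w, hw, hw'⟩ : ∃ w ∈ S, w ∉ ({x, a, b} : Finset V) := by
    apply Finset.exists_mem_notMem_of_card_lt_card
    have := Finset.card_le_three (a := x) (b := a) (c := b)
    omega
  simp only [Finset.mem_insert, Finset.mem_singleton, not_or] at hw'
  obtain ⟨v, hv, hwv⟩ := exists_adj_of_inDeg_ne_zero (G := G) (S := S) (x := w)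
    (by rw [hreg w hw]; omega)
  obtain ⟨u, hu, huv, hwu, hwn⟩ := inDeg_eq_two (hreg w hw) hv hwv
  have hM := matchable_erase_erase h isMatchingGraph_bot hwn
  have hvx : x ≠ v := by rintro rfl; have := hxn w hw hwv.symm; tauto
  have hva : a ≠ v := by rintro rfl; have := han w hw hwv.symm; tauto
  have hvb : b ≠ v := by rintro rfl; have := hbn w hw hwv.symm; tauto
  have hsub : (S.erase v).erase w ⊆ S :=
    (Finset.erase_subset _ _).trans (Finset.erase_subset _ _)
  refine hM.false_of_triangle (x := x) (a := a) (b := b) ?_ ?_ ?_ ?_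
    (fun z hz hz' => hxn z (hsub hz) hz'.1) (fun z hz hz' => han z (hsub hz) hz'.1)
    (fun z hz hz' => hbn z (hsub hz) hz'.1) hxa.ne hxb.ne hab
  · have := Finset.card_erase_add_one hv
    have := Finset.card_erase_add_one (Finset.mem_erase.2 ⟨hwv.ne, hw⟩ : w ∈ S.erase v)
    omega
  all_goals simp only [Finset.mem_erase]; tauto

/-- If a' and b' differ, deleting aa' and bb' leaves a and b with x as only possible partner. An
edge wu away from these five vertices provides the two losses that make the matching perfect. -/
lemma eq_of_erase_robust {G : SimpleGraph V} {S : Finset V} {n : ℕ} (hn : 4 ≤ n)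
    (h : ∀ v, Robust G (S.erase v) (2 * n)) (hcard : S.card = 2 * n + 2)
    (hreg : ∀ x ∈ S, inDeg G S x = 2) {x a b a' b' : V} (hx : x ∈ S) (ha : a ∈ S) (hb : b ∈ S)
    (ha' : a' ∈ S) (hb' : b' ∈ S) (hxa : G.Adj x a) (hxb : G.Adj x b) (hab : a ≠ b)
    (haa' : G.Adj a a') (hbb' : G.Adj b b') (ha'x : a' ≠ x) (hb'x : b' ≠ x) : a' = b' := by
  by_contra hne
  have hnab := not_adj_of_erase_robust (by omega) h hcard hreg hx ha hb hxa hxb hab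
  have hxn := eq_or_eq_of_inDeg_eq_two (hreg x hx) ha hxa hb hxb hab
  have han := eq_or_eq_of_inDeg_eq_two (hreg a ha) hx hxa.symm ha' haa' ha'x.symm
  have hbn := eq_or_eq_of_inDeg_eq_two (hreg b hb) hx hxb.symm hb' hbb' hb'x.symm
  have hab' : a ≠ b' := by rintro rfl; exact hnab hbb'.symm
  have hba' : b ≠ a' := by rintro rfl; exact hnab haa'
  set O : Finset V := S \ {x, a, b, a', b'} with hO
  have hOmem : ∀ z, z ∈ O ↔ z ∈ S ∧ z ≠ x ∧ z ≠ a ∧ z ≠ b ∧ z ≠ a' ∧ z ≠ b' := by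
    intro z; simp [hO]
  have hOcard : 3 ≤ O.card := by
    have h1 : _ ≤ O.card := Finset.le_card_sdiff ({x, a, b, a', b'} : Finset V) S
    have h2 := Finset.card_le_five (a := x) (b := a) (c := b) (d := a') (e := b')
    omega
  obtain ⟨w, hw, u, hu, hwu⟩ : ∃ w ∈ O, ∃ u ∈ O, G.Adj w u := by
    by_contra! hcon
    -- If `O` spanned no edge, each of its at least three vertices would be joined to both `a'` and
    -- `b'`, against the degree 2 of `a'`.
    have h3 := card_le_inDeg (G := G) (S := S) (A := O) (x := a') (by
      intro w hw
      have hw' := (hOmem w).1 hw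
      refine ⟨hw'.1, ?_⟩
      have key : ∀ z ∈ S, G.Adj w z → z = a' ∨ z = b' := by
        intro z hz hwz
        have h1 : z ∉ O := fun hzO => hcon w hw z hzO hwz
        rw [hOmem] at h1
        have : z ≠ x := by rintro rfl; have := hxn w hw'.1 hwz.symm; tauto
        have : z ≠ a := by rintro rfl; have := han w hw'.1 hwz.symm; tauto
        have : z ≠ b := by rintro rfl; have := hbn w hw'.1 hwz.symm; tauto
        tauto
      obtain ⟨v, hv, hwv⟩ := exists_adj_of_inDeg_ne_zero (G := G) (S := S) (x := w)
        (by rw [hreg w hw'.1]; omega)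
      obtain ⟨u, hu, huv, hwu, -⟩ := inDeg_eq_two (hreg w hw'.1) hv hwv
      obtain rfl | rfl := key v hv hwv
      · exact hwv.symm
      · obtain rfl | rfl := key u hu hwu
        · exact hwu.symm
        · exact absurd rfl huv)
    rw [hreg a' ha'] at h3
    omega
  have hw' := (hOmem w).1 hw
  have hu' := (hOmem u).1 hu
  obtain ⟨v, hv, hvu, hwv, hwn⟩ := inDeg_eq_two (hreg w hw'.1) hu'.1 hwu
  have hM := matchable_erase_erase h ((isMatchingGraph_bot.pairUp a a').pairUp b b')
    (fun z hz hwz => (hwn z hz hwz).symm)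
  have hva : a ≠ v := by rintro rfl; have := han w hw'.1 hwv.symm; tauto
  have hvb : b ≠ v := by rintro rfl; have := hbn w hw'.1 hwv.symm; tauto
  have hsub : (S.erase v).erase w ⊆ S :=
    (Finset.erase_subset _ _).trans (Finset.erase_subset _ _)
  refine hM.false_of_cherry (x := x) (a := a) (b := b) ?_ ?_ ?_ hab ?_ ?_
  · have := Finset.card_erase_add_one hv
    have := Finset.card_erase_add_one (Finset.mem_erase.2 ⟨hwv.ne, hw'.1⟩ : w ∈ S.erase v)
    omega
  · simp only [Finset.mem_erase]; tauto
  · simp only [Finset.mem_erase]; tauto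
  · rintro z hz ⟨h1, h2⟩
    refine (han z (hsub hz) h1).resolve_right ?_
    rintro rfl
    apply h2
    rw [pairUp_adj_of_ne (by tauto) (by tauto) (by tauto) (by tauto),
      pairUp_adj_of_ne hab hab' (Ne.symm hba') hne]
    exact pairUp_adj_self h1.ne
  · rintro z hz ⟨h1, h2⟩
    refine (hbn z (hsub hz) h1).resolve_right ?_
    rintro rfl
    apply h2
    rw [pairUp_adj_of_ne (by tauto) (by tauto) (by tauto) (by tauto)]
    exact pairUp_adj_self h1.ne

/-- In the extremal case all components are cycles of length four. -/
theorem four_dvd_card_of_erase_robust {G : SimpleGraph V} {S : Finset V} {n : ℕ} (hn : 4 ≤ n)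
    (h : ∀ v, Robust G (S.erase v) (2 * n)) (hcard : S.card = 2 * n + 2)
    (hreg : ∀ x ∈ S, inDeg G S x = 2) : 4 ∣ S.card := by
  classical
  -- The ball of radius 2 about `x` is its 4-cycle, so these balls partition `S` into blocks of size
  -- 4.
  let c : V → Finset V := fun x =>
    S.filter fun y => y = x ∨ G.Adj x y ∨ ∃ w ∈ S, G.Adj x w ∧ G.Adj w y
  have hc : ∀ x ∈ S, (c x).card = 4 ∧ ∀ y ∈ c x, c y = c x := by
    intro x hx
    obtain ⟨a, ha, hxa⟩ := exists_adj_of_inDeg_ne_zero (G := G) (S := S) (x := x)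
      (by rw [hreg x hx]; omega)
    obtain ⟨b, hb, hba, hxb, hxn⟩ := inDeg_eq_two (hreg x hx) ha hxa
    obtain ⟨y, hy, hyx, hay, han⟩ := inDeg_eq_two (hreg a ha) hx hxa.symm
    obtain ⟨y', hy', hyx', hby, hbn⟩ := inDeg_eq_two (hreg b hb) hx hxb.symm
    obtain rfl := eq_of_erase_robust hn h hcard hreg hx ha hb hy hy' hxa hxb hba.symm hay hby
      hyx hyx'
    have hyn := eq_or_eq_of_inDeg_eq_two (hreg y hy) ha hay.symm hb hby.symm hba.symm
    have key : ∀ {x a b y : V}, x ∈ S → a ∈ S → b ∈ S → y ∈ S → G.Adj x a → G.Adj x b →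
        G.Adj a y → (∀ z ∈ S, G.Adj x z → z = a ∨ z = b) → (∀ z ∈ S, G.Adj a z → z = x ∨ z = y) →
        (∀ z ∈ S, G.Adj b z → z = x ∨ z = y) → c x = {x, a, b, y} := by
      intro x a b y hx ha hb hy hxa hxb hay hxn han hbn
      ext z
      simp only [c, Finset.mem_filter, Finset.mem_insert, Finset.mem_singleton]
      constructor
      · rintro ⟨hz, rfl | hxz | ⟨w, hw, hxw, hwz⟩⟩
        · tauto
        · have := hxn z hz hxz
          tauto
        · obtain rfl | rfl := hxn w hw hxw
          · have := han z hz hwz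
            tauto
          · have := hbn z hz hwz
            tauto
      · rintro (rfl | rfl | rfl | rfl)
        · exact ⟨hx, Or.inl rfl⟩
        · exact ⟨ha, Or.inr (Or.inl hxa)⟩
        · exact ⟨hb, Or.inr (Or.inl hxb)⟩
        · exact ⟨hy, Or.inr (Or.inr ⟨a, ha, hxa, hay⟩)⟩
    have hcx : c x = {x, a, b, y} := key hx ha hb hy hxa hxb hay hxn han hbn
    rw [hcx]
    constructor
    · simp [Finset.card_insert_of_notMem, hxa.ne, hxb.ne, hay.ne, hby.ne, hba.symm, hyx.symm]
    · simp only [Finset.mem_insert, Finset.mem_singleton]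
      rintro z (rfl | rfl | rfl | rfl)
      · exact hcx
      · rw [key ha hx hy hb hxa.symm hay hxb han hxn hyn]
        ext w
        simp only [Finset.mem_insert, Finset.mem_singleton]
        tauto
      · rw [key hb hx hy ha hxb.symm hby hxa hbn (fun z hz h => (hxn z hz h).symm)
          (fun z hz h => (hyn z hz h).symm)]
        ext w
        simp only [Finset.mem_insert, Finset.mem_singleton]
        tauto
      · rw [key hy ha hb hx hay.symm hby.symm hxa.symm hyn (fun z hz h => (han z hz h).symm)
          (fun z hz h => (hbn z hz h).symm)]
        ext w
        simp only [Finset.mem_insert, Finset.mem_singleton]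
        tauto
  rw [Finset.card_eq_sum_card_image c S]
  refine Finset.dvd_sum fun s hs => ?_
  obtain ⟨x, hx, rfl⟩ := Finset.mem_image.1 hs
  have : S.filter (fun y => c y = c x) = c x := by
    ext y
    constructor
    · intro hy
      obtain ⟨hy, hyx⟩ := Finset.mem_filter.1 hy
      rw [← hyx]
      exact Finset.mem_filter.2 ⟨hy, Or.inl rfl⟩
    · exact fun hy => Finset.mem_filter.2 ⟨(Finset.mem_filter.1 hy).1, (hc x hx).2 y hy⟩
  rw [this, (hc x hx).1]

end FanRamsey

/-! ### Lower bound for n ≥ 2, by the number of possible centres -/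

namespace FanRamsey

variable {V : Type*}

/-- After the deletion of any matching, `G` contains the fan `F_n`. -/
def FanRobust (G : SimpleGraph V) (n : ℕ) : Prop :=
  ∀ R, IsMatchingGraph R → ∃ u, ∃ N : Finset V, (∀ y ∈ N, (G \ R).Adj u y) ∧
    Matchable (G \ R) N (2 * n)

lemma IsMatchingGraph.not_isContained {R : SimpleGraph V} (hR : IsMatchingGraph R) :
    ¬ (SimpleGraph.pathGraph 3).IsContained R := by
  rintro ⟨f⟩
  have h1 : R.Adj (f 1) (f 0) := f.toHom.map_adj (by simp [SimpleGraph.pathGraph_adj])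
  have h2 : R.Adj (f 1) (f 2) := f.toHom.map_adj (by simp [SimpleGraph.pathGraph_adj])
  exact absurd (f.injective (hR h1 h2)) (by decide)

lemma matchable_of_fan_isContained {B : SimpleGraph V} {n : ℕ} (h : (fan n).IsContained B) :
    ∃ u, ∃ N : Finset V, (∀ y ∈ N, B.Adj u y) ∧ Matchable B N (2 * n) := by
  classical
  obtain ⟨f⟩ := h
  let g : Fin n × Bool → V := fun p => f (some p)
  have hg : Function.Injective g := fun p q hpq => Option.some_injective _ (f.injective hpq)
  refine ⟨f none, Finset.univ.image g, ?_, Finset.univ.image g, subset_rfl, ?_,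
    fun y => if h : ∃ p, g p = y then g (h.choose.1, !h.choose.2) else y, ?_⟩
  · intro y hy
    obtain ⟨p, -, rfl⟩ := Finset.mem_image.1 hy
    exact f.toHom.map_adj (show (fan n).Adj none (some p) from trivial)
  · rw [Finset.card_image_of_injective _ hg]
    simp [mul_comm]
  · have key : ∀ p, (if h : ∃ q, g q = g p then g (h.choose.1, !h.choose.2) else g p) =
        g (p.1, !p.2) := by
      intro p
      have h : ∃ q, g q = g p := ⟨p, rfl⟩
      rw [dif_pos h, hg h.choose_spec]
    intro y hy
    obtain ⟨p, -, rfl⟩ := Finset.mem_image.1 hy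
    simp only [key]
    refine ⟨Finset.mem_image_of_mem _ (Finset.mem_univ _), f.toHom.map_adj ?_, ?_⟩
    · exact (⟨rfl, by simp⟩ : p.1 = p.1 ∧ p.2 ≠ !p.2)
    · simp

lemma fanRobust_of_arrows {G : SimpleGraph V} {n : ℕ}
    (h : Arrows G (SimpleGraph.pathGraph 3) (fan n)) : FanRobust G n := by
  intro R hR
  have hR' : IsMatchingGraph (G ⊓ R) := fun x a b ha hb => hR ha.2 hb.2
  refine matchable_of_fan_isContained ((h (G ⊓ R) (G \ R) ?_ ?_).resolve_left hR'.not_isContained)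
  · exact sup_inf_sdiff G R
  · exact disjoint_inf_sdiff

lemma inDeg_mono (G : SimpleGraph V) {S T : Finset V} (h : S ⊆ T) (x : V) :
    inDeg G S x ≤ inDeg G T x := by
  classical
  exact Finset.card_le_card (Finset.filter_subset_filter _ h)

lemma darts_mono (G : SimpleGraph V) {S T : Finset V} (h : S ⊆ T) : darts G S ≤ darts G T :=
  (Finset.sum_le_sum fun x _ => inDeg_mono G h x).trans (Finset.sum_le_sum_of_subset h)

lemma inDeg_le_darts (G : SimpleGraph V) {S : Finset V} {x : V} (hx : x ∈ S) :
    inDeg G S x ≤ darts G S :=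
  Finset.single_le_sum (f := fun x => inDeg G S x) (fun _ _ => Nat.zero_le _) hx

lemma darts_univ [Fintype V] (G : SimpleGraph V) : darts G Finset.univ = 2 * G.edgeSet.ncard := by
  classical
  rw [Set.ncard_eq_toFinset_card', ← SimpleGraph.edgeFinset,
    ← SimpleGraph.sum_degrees_eq_twice_card_edges, darts]
  refine Finset.sum_congr rfl fun x _ => ?_
  rw [inDeg, ← SimpleGraph.card_neighborFinset_eq_degree, SimpleGraph.neighborFinset_eq_filter]

lemma two_mul_le_inDeg {G R : SimpleGraph V} {u : V} {N S : Finset V} {n : ℕ}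
    (hN : ∀ y ∈ N, (G \ R).Adj u y) (hM : Matchable (G \ R) N (2 * n)) (hS : N ⊆ S) :
    2 * n ≤ inDeg G S u :=
  hM.le_card.trans (card_le_inDeg fun y hy => ⟨hS hy, (hN y hy).1⟩)

variable [DecidableEq V]

/-- Deleting a first matching on m vertices leaves a second, edge-disjoint from it; each covered
vertex sends one dart into each matching covering it. -/
lemma Robust.le_darts {G : SimpleGraph V} {S : Finset V} {m : ℕ} (h : Robust G S m) :
    2 * m ≤ darts G S := by
  obtain ⟨T, hT, hTm, σ, hσ⟩ := h ⊥ isMatchingGraph_bot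
  let R : SimpleGraph V :=
    { Adj := fun a b => a ∈ T ∧ b ∈ T ∧ σ a = b ∧ a ≠ b
      symm := ⟨by
        rintro a b ⟨ha, hb, rfl, hne⟩
        exact ⟨hb, ha, (hσ a ha).2.2, hne.symm⟩⟩
      loopless := ⟨fun a ha => ha.2.2.2 rfl⟩ }
  obtain ⟨T', hT', hTm', σ', hσ'⟩ := h R fun x a b ha hb => ha.2.2.1.symm.trans hb.2.2.1
  have key : ∀ x ∈ S, (if x ∈ T then 1 else 0) + (if x ∈ T' then 1 else 0) ≤ inDeg G S x := by
    intro x hx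
    have h1 : x ∈ T → σ x ∈ S ∧ G.Adj x (σ x) := fun hx =>
      ⟨hT (hσ x hx).1, (hσ x hx).2.1.1⟩
    have h2 : x ∈ T' → σ' x ∈ S ∧ G.Adj x (σ' x) := fun hx =>
      ⟨hT' (hσ' x hx).1, (hσ' x hx).2.1.1⟩
    have h3 : x ∈ T → x ∈ T' → σ x ≠ σ' x := by
      intro hx hx' heq
      refine (hσ' x hx').2.1.2 ⟨hx, ?_, heq, (h2 hx').2.ne⟩
      rw [← heq]
      exact (hσ x hx).1
    split_ifs with hxT hxT' hxT'
    · have := card_le_inDeg (G := G) (S := S) (A := {σ x, σ' x}) (x := x) (by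
        simp only [Finset.mem_insert, Finset.mem_singleton]
        rintro y (rfl | rfl)
        exacts [h1 hxT, h2 hxT'])
      rwa [Finset.card_pair (h3 hxT hxT')] at this
    · have := card_le_inDeg (G := G) (S := S) (A := {σ x}) (x := x) (by
        simp only [Finset.mem_singleton]
        rintro y rfl
        exact h1 hxT)
      simpa using this
    · have := card_le_inDeg (G := G) (S := S) (A := {σ' x}) (x := x) (by
        simp only [Finset.mem_singleton]
        rintro y rfl
        exact h2 hxT')
      simpa using this
    · omega
  have h4 := Finset.sum_le_sum key
  rw [Finset.sum_add_distrib, ← Finset.card_filter, ← Finset.card_filter,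
    Finset.filter_mem_eq_inter, Finset.filter_mem_eq_inter, Finset.inter_eq_right.2 hT,
    Finset.inter_eq_right.2 hT'] at h4
  rw [darts]
  omega

variable [Fintype V]

/-- The lower bound when all the fans have the same centre. -/
lemma darts_ge_of_unique_center {G : SimpleGraph V} {n : ℕ} (hn : 0 < n) {u : V}
    (h : ∀ R, IsMatchingGraph R → ∃ N : Finset V, (∀ y ∈ N, (G \ R).Adj u y) ∧
      Matchable (G \ R) N (2 * n)) :
    8 * n + 8 ≤ darts G Finset.univ ∧
      (4 ≤ n → Even n → 8 * n + 10 ≤ darts G Finset.univ) := by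
  classical
  have : Nonempty V := ⟨u⟩
  set S : Finset V := Finset.univ.filter fun y => G.Adj u y with hS
  have hcost : 2 * S.card + darts G S ≤ darts G Finset.univ := by
    have h1 := darts_erase G (Finset.mem_univ u)
    have h2 : darts G S ≤ darts G (Finset.univ.erase u) := darts_mono G fun y hy =>
      Finset.mem_erase.2 ⟨(Finset.mem_filter.1 hy).2.ne', Finset.mem_univ _⟩
    have h3 : inDeg G Finset.univ u = S.card := by
      rw [inDeg, hS]
    omega
  have hrob : ∀ v, Robust G (S.erase v) (2 * n) := by
    intro v R hR
    -- The spoke `uv` is deleted together with the part of `R` away from `u` and `v`.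
    obtain ⟨N, hN, hM⟩ := h _ (hR.pairUp u v)
    have hNv : ∀ y ∈ N, y ≠ u ∧ y ≠ v := by
      intro y hy
      refine ⟨(hN y hy).ne', ?_⟩
      rintro rfl
      exact (hN y hy).2 (pairUp_adj_self (hN y hy).ne)
    refine hM.mono (fun y hy => ?_) ?_
    · exact Finset.mem_erase.2 ⟨(hNv y hy).2, Finset.mem_filter.2 ⟨Finset.mem_univ _, (hN y hy).1⟩⟩
    · rintro a ha b hb ⟨h1, h2⟩
      refine ⟨h1, ?_⟩
      rwa [pairUp_adj_of_ne (hNv a ha).1 (hNv a ha).2 (hNv b hb).1 (hNv b hb).2] at h2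
  have hreg := regular_of_erase_robust hn S hrob
  constructor
  · by_contra! hlt
    have h1 := hreg (by omega)
    have h2 := darts_of_forall h1.2
    omega
  · intro hn4 heven
    by_contra! hlt
    have h0 := darts_univ G
    obtain ⟨k, rfl⟩ := heven
    have h1 := hreg (by omega)
    have h2 := four_dvd_card_of_erase_robust hn4 hrob h1.1 h1.2
    omega

/-- A fan centred at u or w loses at most one of its n matching edges when both are removed, so the
rest has at least `4 * n - 4` darts. If uw is an edge, it is counted at both ends; deleting it shows
that one centre has degree at least `2 * n + 1`, which compensates. -/
lemma darts_ge_of_two_centers {G : SimpleGraph V} {n : ℕ} (h : FanRobust G n) (hn : 2 ≤ n)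
    {u w : V} (huw : u ≠ w) (hu : 2 * n ≤ inDeg G Finset.univ u)
    (hw : 2 * n ≤ inDeg G Finset.univ w)
    (hc : ∀ z, 2 * n ≤ inDeg G Finset.univ z → z = u ∨ z = w) :
    12 * n - 4 ≤ darts G Finset.univ := by
  obtain ⟨k, rfl⟩ : ∃ k, n = k + 1 := ⟨n - 1, by omega⟩
  have hrob : Robust G ((Finset.univ.erase u).erase w) (2 * k) := by
    intro R hR
    obtain ⟨c, N, hN, hM⟩ := h R hR
    have hsub : N ⊆ Finset.univ.erase c := fun y hy =>
      Finset.mem_erase.2 ⟨(hN y hy).ne', Finset.mem_univ _⟩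
    obtain rfl | rfl := hc c (two_mul_le_inDeg hN hM (Finset.subset_univ _))
    · exact (Matchable.erase hM w).mono (Finset.erase_subset_erase _ hsub) fun _ _ _ _ => id
    · rw [Finset.erase_right_comm]
      exact (Matchable.erase hM u).mono (Finset.erase_subset_erase _ hsub) fun _ _ _ _ => id
  have h1 := hrob.le_darts
  have h2 := darts_erase G (Finset.mem_univ u)
  have h3 := darts_erase G (Finset.mem_erase.2 ⟨huw.symm, Finset.mem_univ w⟩)
  have h4 := inDeg_erase G (Finset.mem_univ u) w
  have h5 := inDeg_erase G (Finset.mem_univ w) u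
  by_cases hadj : G.Adj u w
  · rw [if_pos hadj] at h5
    rw [if_pos hadj.symm] at h4
    by_contra! hlt
    obtain ⟨c, N, hN, hM⟩ := h _ (isMatchingGraph_bot.pairUp u w)
    obtain rfl | rfl := hc c (two_mul_le_inDeg hN hM (Finset.subset_univ _))
    · have := two_mul_le_inDeg hN hM (S := Finset.univ.erase w) fun y hy =>
        Finset.mem_erase.2 ⟨by rintro rfl; exact (hN y hy).2 (pairUp_adj_self huw),
          Finset.mem_univ _⟩
      omega
    · have := two_mul_le_inDeg hN hM (S := Finset.univ.erase u) fun y hy =>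
        Finset.mem_erase.2 ⟨by rintro rfl; exact (hN y hy).2 (pairUp_adj_self huw).symm,
          Finset.mem_univ _⟩
      omega
  · rw [if_neg fun h => hadj h.symm] at h4
    omega

/-- The bound can fail only if u, w, x form a triangle, have degree exactly `2 * n` and meet every
edge. Deleting uw and another edge at x then disqualifies all three, and any other vertex has degree
at most 3. -/
lemma darts_ge_of_three_centers {G : SimpleGraph V} {n : ℕ} (h : FanRobust G n) (hn : 2 ≤ n)
    {u w x : V} (huw : u ≠ w) (hux : u ≠ x) (hwx : w ≠ x) (hu : 2 * n ≤ inDeg G Finset.univ u)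
    (hw : 2 * n ≤ inDeg G Finset.univ w) (hx : 2 * n ≤ inDeg G Finset.univ x) :
    12 * n - 4 ≤ darts G Finset.univ := by
  classical
  have hwU : w ∈ Finset.univ.erase u := Finset.mem_erase.2 ⟨huw.symm, Finset.mem_univ w⟩
  have hxU : x ∈ (Finset.univ.erase u).erase w :=
    Finset.mem_erase.2 ⟨hwx.symm, Finset.mem_erase.2 ⟨hux.symm, Finset.mem_univ x⟩⟩
  have d1 := darts_erase G (Finset.mem_univ u)
  have d2 := darts_erase G hwU
  have d3 := darts_erase G hxU
  have i1 := inDeg_erase G (Finset.mem_univ u)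
  have i2 := inDeg_erase G hwU
  have i3 := inDeg_erase G hxU
  have bound : ∀ a b, (if G.Adj a b then 1 else 0) ≤ 1 := fun a b => by split_ifs <;> simp
  have b1 := bound w u
  have b2 := bound x u
  have b3 := bound x w
  have e1 := i1 w
  have e2 := i1 x
  have e3 := i2 x
  by_contra! hlt
  have heven := darts_univ G
  have hwu : G.Adj w u := by by_contra hn; rw [if_neg hn] at e1; omega
  have hxu : G.Adj x u := by by_contra hn; rw [if_neg hn] at e2; omega
  have hxw : G.Adj x w := by by_contra hn; rw [if_neg hn] at e3; omega
  obtain ⟨y, hy, hxy⟩ := exists_adj_of_inDeg_ne_zero (G := G)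
    (S := (Finset.univ.erase u).erase w) (x := x) (by omega)
  obtain ⟨c, N, hN, hM⟩ := h _ ((isMatchingGraph_bot.pairUp x y).pairUp u w)
  have hcdeg := two_mul_le_inDeg hN hM (Finset.subset_univ _)
  have erase_le : ∀ v, (∀ z ∈ N, z ≠ v) → 2 * n ≤ inDeg G (Finset.univ.erase v) c := fun v hv =>
    two_mul_le_inDeg hN hM fun z hz => Finset.mem_erase.2 ⟨hv z hz, Finset.mem_univ _⟩
  by_cases hcu : c = u
  · subst hcu
    have := erase_le w (by rintro z hz rfl; exact (hN z hz).2 (pairUp_adj_self huw))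
    have := inDeg_erase G (Finset.mem_univ w) c
    rw [if_pos hwu.symm] at this
    omega
  by_cases hcw : c = w
  · subst hcw
    have := erase_le u (by rintro z hz rfl; exact (hN z hz).2 (pairUp_adj_self huw).symm)
    rw [if_pos hwu] at e1
    omega
  by_cases hcx : c = x
  · subst hcx
    have hy' := Finset.mem_erase.1 hy
    have := erase_le y (by
      rintro z hz rfl
      refine (hN z hz).2 ?_
      rw [pairUp_adj_of_ne hcu hcw (Finset.mem_erase.1 hy'.2).1 hy'.1]
      exact pairUp_adj_self hxy.ne)
    have := inDeg_erase G (Finset.mem_univ y) c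
    rw [if_pos hxy] at this
    omega
  have hc1 := bound c u
  have hc2 := bound c w
  have hc3 := bound c x
  have := i1 c
  have := i2 c
  have := i3 c
  have := inDeg_le_darts G (x := c) (S := ((Finset.univ.erase u).erase w).erase x)
    (by simp only [Finset.mem_erase]; exact ⟨hcx, hcw, hcu, Finset.mem_univ _⟩)
  omega

theorem FanRobust.darts_ge {G : SimpleGraph V} {n : ℕ} (h : FanRobust G n) (hn : 2 ≤ n) :
    (8 * n + 8 ≤ darts G Finset.univ ∧
      (4 ≤ n → Even n → 8 * n + 10 ≤ darts G Finset.univ)) ∨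
    12 * n - 4 ≤ darts G Finset.univ := by
  obtain ⟨u, N, hN, hM⟩ := h ⊥ isMatchingGraph_bot
  have hu := two_mul_le_inDeg hN hM (Finset.subset_univ _)
  by_cases h1 : ∀ z, 2 * n ≤ inDeg G Finset.univ z → z = u
  · left
    refine darts_ge_of_unique_center (u := u) (by omega) fun R hR => ?_
    obtain ⟨c, N', hN', hM'⟩ := h R hR
    obtain rfl := h1 c (two_mul_le_inDeg hN' hM' (Finset.subset_univ _))
    exact ⟨N', hN', hM'⟩
  · right
    push Not at h1
    obtain ⟨w, hw, hwu⟩ := h1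
    by_cases h2 : ∀ z, 2 * n ≤ inDeg G Finset.univ z → z = u ∨ z = w
    · exact darts_ge_of_two_centers h hn hwu.symm hu hw h2
    · push Not at h2
      obtain ⟨x, hx, hxu, hxw⟩ := h2
      exact darts_ge_of_three_centers h hn hwu.symm hxu.symm hxw.symm hu hw hx

end FanRamsey

/-! ### The triangle case n = 1 -/

namespace FanRamsey

variable {V : Type*}

lemma FanRobust.exists_triangle {G : SimpleGraph V} (h : FanRobust G 1) {R : SimpleGraph V}
    (hR : IsMatchingGraph R) :
    ∃ p q r, (G \ R).Adj p q ∧ (G \ R).Adj p r ∧ (G \ R).Adj q r := by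
  obtain ⟨u, N, hN, T, hT, hT2, σ, hσ⟩ := h R hR
  obtain ⟨x, hx⟩ : T.Nonempty := Finset.card_pos.1 (by omega)
  exact ⟨u, x, σ x, hN _ (hT hx), hN _ (hT (hσ x hx).1), (hσ x hx).2.1⟩

lemma eq_pair_of_mem_triple {x y z p q r : V} (hx : x = p ∨ x = q ∨ x = r)
    (hy : y = p ∨ y = q ∨ y = r) (hz : z = p ∨ z = q ∨ z = r) (hxy : x ≠ y) (hxz : x ≠ z)
    (hyz : y ≠ z) : (x = p ∧ y = q) ∨ (x = q ∧ y = p) ∨ (x = p ∧ z = q) ∨ (x = q ∧ z = p) ∨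
      (y = p ∧ z = q) ∨ (y = q ∧ z = p) := by
  rcases hx with rfl | rfl | rfl <;> rcases hy with rfl | rfl | rfl <;> tauto

/-- If v lies in the single triangle vab, deleting ab leaves a triangle pqr avoiding v, with an edge
pq missing a and b. Deleting ab and pq leaves a third triangle with a vertex z outside pqr; its two
edges at z are new, and 3 + 3 + 2 = 8. -/
lemma FanRobust.eight_le_of_vertex {G : SimpleGraph V} [Finite V] (h : FanRobust G 1) {v a b : V}
    (hva : G.Adj v a) (hvb : G.Adj v b) (hab : G.Adj a b)
    (hv : ∀ c d, G.Adj v c → G.Adj v d → G.Adj c d → c = a ∨ c = b) :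
    8 ≤ G.edgeSet.ncard := by
  classical
  have avoid : ∀ R : SimpleGraph V, R.Adj a b → ∀ p q r, (G \ R).Adj p q → (G \ R).Adj p r →
      (G \ R).Adj q r → p ≠ v ∧ ¬ (p = a ∧ q = b) ∧ ¬ (p = b ∧ q = a) := by
    intro R hR p q r hpq hpr hqr
    refine ⟨?_, ?_, ?_⟩
    · rintro rfl
      have h1 := hv q r hpq.1 hpr.1 hqr.1
      have h2 := hv r q hpr.1 hpq.1 hqr.1.symm
      have h3 := hqr.2
      have h4 := hqr.ne
      have h5 := hR.symm
      grind
    · rintro ⟨rfl, rfl⟩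
      exact hpq.2 hR
    · rintro ⟨rfl, rfl⟩
      exact hpq.2 hR.symm
  obtain ⟨p, q, r, hpq, hpr, hqr, hp, hq⟩ : ∃ p q r, (G \ pairUp ⊥ a b).Adj p q ∧
      (G \ pairUp ⊥ a b).Adj p r ∧ (G \ pairUp ⊥ a b).Adj q r ∧ (p ≠ a ∧ p ≠ b) ∧
      (q ≠ a ∧ q ≠ b) := by
    obtain ⟨p, q, r, hpq, hpr, hqr⟩ := h.exists_triangle (isMatchingGraph_bot.pairUp a b)
    have h1 := avoid _ (pairUp_adj_self hab.ne) p q r hpq hpr hqr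
    have h2 := avoid _ (pairUp_adj_self hab.ne) p r q hpr hpq hqr.symm
    have h3 := avoid _ (pairUp_adj_self hab.ne) q r p hqr hpq.symm hpr.symm
    have := hpq.ne
    have := hpr.ne
    have := hqr.ne
    by_cases hp : p = a ∨ p = b
    · exact ⟨q, r, p, hqr, hpq.symm, hpr.symm, by grind, by grind⟩
    · by_cases hq : q = a ∨ q = b
      · exact ⟨p, r, q, hpr, hpq, hqr.symm, by grind, by grind⟩
      · exact ⟨p, q, r, hpq, hpr, hqr, not_or.1 hp, not_or.1 hq⟩
  have hpq' : (pairUp (pairUp ⊥ p q) a b).Adj a b := pairUp_adj_self hab.ne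
  have hpq'' : (pairUp (pairUp ⊥ p q) a b).Adj p q := by
    rw [pairUp_adj_of_ne hp.1 hp.2 hq.1 hq.2]
    exact pairUp_adj_self hpq.ne
  have v1 := (avoid _ (pairUp_adj_self hab.ne) p q r hpq hpr hqr).1
  have v2 := (avoid _ (pairUp_adj_self hab.ne) q r p hqr hpq.symm hpr.symm).1
  have v3 := (avoid _ (pairUp_adj_self hab.ne) r p q hpr.symm hqr.symm hpq).1
  have n1 := (avoid _ (pairUp_adj_self hab.ne) p r q hpr hpq hqr.symm).2
  have n2 := (avoid _ (pairUp_adj_self hab.ne) q r p hqr hpq.symm hpr.symm).2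
  obtain ⟨x, y, z, hxy, hxz, hyz, hz⟩ : ∃ x y z,
      (G \ pairUp (pairUp ⊥ p q) a b).Adj x y ∧ (G \ pairUp (pairUp ⊥ p q) a b).Adj x z ∧
      (G \ pairUp (pairUp ⊥ p q) a b).Adj y z ∧ z ≠ p ∧ z ≠ q ∧ z ≠ r := by
    obtain ⟨x, y, z, hxy, hxz, hyz⟩ :=
      h.exists_triangle ((isMatchingGraph_bot.pairUp p q).pairUp a b)
    by_cases hz : z = p ∨ z = q ∨ z = r
    · by_cases hy : y = p ∨ y = q ∨ y = r
      · by_cases hx : x = p ∨ x = q ∨ x = r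
        · exfalso
          have h1 := hxy.2
          have h2 := hxz.2
          have h3 := hyz.2
          obtain ⟨rfl, rfl⟩ | ⟨rfl, rfl⟩ | ⟨rfl, rfl⟩ | ⟨rfl, rfl⟩ | ⟨rfl, rfl⟩ | ⟨rfl, rfl⟩ :=
            eq_pair_of_mem_triple hx hy hz hxy.ne hxz.ne hyz.ne
          exacts [h1 hpq'', h1 hpq''.symm, h2 hpq'', h2 hpq''.symm, h3 hpq'', h3 hpq''.symm]
        · exact ⟨y, z, x, hyz, hxy.symm, hxz.symm, by simpa only [not_or] using hx⟩
      · exact ⟨x, z, y, hxz, hxy, hyz.symm, by simpa only [not_or] using hy⟩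
    · exact ⟨x, y, z, hxy, hxz, hyz, by simpa only [not_or] using hz⟩
  have w1 := avoid _ hpq' x y z hxy hxz hyz
  have w2 := avoid _ hpq' y z x hyz hxy.symm hxz.symm
  have w3 := avoid _ hpq' z x y hxz.symm hyz.symm hxy
  have hF : (({s(v, a), s(v, b), s(a, b), s(p, q), s(p, r), s(q, r), s(x, z), s(y, z)} :
      Finset (Sym2 V)) : Set (Sym2 V)) ⊆ G.edgeSet := by
    intro e he
    simp only [Finset.coe_insert, Finset.coe_singleton, Set.mem_insert_iff,
      Set.mem_singleton_iff] at he
    rcases he with rfl | rfl | rfl | rfl | rfl | rfl | rfl | rfl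
    exacts [hva, hvb, hab, hpq.1, hpr.1, hqr.1, hxz.1, hyz.1]
  have hcard := Set.ncard_le_ncard hF (Set.toFinite _)
  rw [Set.ncard_coe_finset] at hcard
  refine le_trans (le_of_eq ?_) hcard
  have := hva.ne
  have := hvb.ne
  have := hab.ne
  have := hpq.ne
  have := hpr.ne
  have := hqr.ne
  have := hxy.ne
  have := hxz.ne
  have := hyz.ne
  clear avoid hv hF hcard hpq' hpq'' hva hvb hab hpq hpr hqr hxy hxz hyz
  symm
  repeat rw [Finset.card_insert_of_notMem]
  · simp
  all_goals
    simp only [Finset.mem_insert, Finset.mem_singleton, Sym2.eq_iff]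
    grind

/-- With at most 7 edges, every vertex on a triangle lies on a second one and so has degree at least
3. Hence at most four vertices lie on triangles, and deleting two disjoint pairs of these four
destroys all triangles. -/
theorem FanRobust.eight_le {G : SimpleGraph V} [Fintype V] (h : FanRobust G 1) :
    8 ≤ G.edgeSet.ncard := by
  classical
  by_contra! hlt
  have hbig : ∀ v a b, G.Adj v a → G.Adj v b → G.Adj a b →
      ∃ c d, G.Adj v c ∧ G.Adj v d ∧ G.Adj c d ∧ c ≠ a ∧ c ≠ b := by
    intro v a b hva hvb hab
    by_contra! hcon
    exact hlt.not_ge (h.eight_le_of_vertex hva hvb hab fun c d h1 h2 h3 =>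
      or_iff_not_imp_left.2 (hcon c d h1 h2 h3))
  let A : Finset V := Finset.univ.filter fun v => ∃ a b, G.Adj v a ∧ G.Adj v b ∧ G.Adj a b
  have hA : ∀ v a b, G.Adj v a → G.Adj v b → G.Adj a b → v ∈ A := fun v a b h1 h2 h3 =>
    Finset.mem_filter.2 ⟨Finset.mem_univ _, a, b, h1, h2, h3⟩
  have hdeg : ∀ v ∈ A, 3 ≤ inDeg G Finset.univ v := by
    intro v hv
    obtain ⟨-, a, b, hva, hvb, hab⟩ := Finset.mem_filter.1 hv
    obtain ⟨c, d, hvc, -, -, hca, hcb⟩ := hbig v a b hva hvb hab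
    rw [← Finset.card_eq_three.2 ⟨a, b, c, hab.ne, hca.symm, hcb.symm, rfl⟩]
    apply card_le_inDeg
    simp only [Finset.mem_insert, Finset.mem_singleton]
    rintro y (rfl | rfl | rfl)
    exacts [⟨Finset.mem_univ _, hva⟩, ⟨Finset.mem_univ _, hvb⟩, ⟨Finset.mem_univ _, hvc⟩]
  have hAcard : A.card ≤ 4 := by
    have h1 := Finset.card_nsmul_le_sum A (fun x => inDeg G Finset.univ x) 3 hdeg
    have h2 : ∑ x ∈ A, inDeg G Finset.univ x ≤ darts G Finset.univ :=
      Finset.sum_le_sum_of_subset (Finset.subset_univ _)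
    rw [darts_univ] at h2
    rw [smul_eq_mul] at h1
    omega
  obtain ⟨v, a, b, hva, hvb, hab⟩ := h.exists_triangle isMatchingGraph_bot
  obtain ⟨c, d, hvc, hvd, hcd, hca, hcb⟩ := hbig v a b hva.1 hvb.1 hab.1
  have hAeq : {v, a, b, c} = A := by
    apply Finset.eq_of_subset_of_card_le
    · simp only [Finset.insert_subset_iff, Finset.singleton_subset_iff]
      exact ⟨hA v a b hva.1 hvb.1 hab.1, hA a v b hva.1.symm hab.1 hvb.1,
        hA b v a hvb.1.symm hab.1.symm hva.1, hA c v d hvc.symm hcd hvd⟩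
    · refine hAcard.trans (le_of_eq ?_)
      simp [Finset.card_insert_of_notMem, hva.ne, hvb.ne, hab.ne, hvc.ne, hca.symm, hcb.symm]
  obtain ⟨p, q, r, hpq, hpr, hqr⟩ :=
    h.exists_triangle ((isMatchingGraph_bot.pairUp v a).pairUp b c)
  have hbc : (pairUp (pairUp ⊥ v a) b c).Adj b c := pairUp_adj_self hcb.symm
  have hva' : (pairUp (pairUp ⊥ v a) b c).Adj v a := by
    rw [pairUp_adj_of_ne hvb.ne hvc.ne hab.ne hca.symm]
    exact pairUp_adj_self hva.ne
  have hp := hA p q r hpq.1 hpr.1 hqr.1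
  have hq := hA q p r hpq.1.symm hqr.1 hpr.1
  have hr := hA r p q hpr.1.symm hqr.1.symm hpq.1
  rw [← hAeq] at hp hq hr
  simp only [Finset.mem_insert, Finset.mem_singleton] at hp hq hr
  have := hpq.ne
  have := hpr.ne
  have := hqr.ne
  have := hpq.2
  have := hpr.2
  have := hqr.2
  have := hbc.symm
  have := hva'.symm
  clear hbig hA hdeg
  grind

end FanRamsey

/-! ### Constructions for the upper bound -/

namespace FanRamsey

lemma arrows_of_forall_matching {V W : Type*} {G : SimpleGraph V} {H : SimpleGraph W}
    (h : ∀ R B : SimpleGraph V, IsMatchingGraph R → (∀ x y, G.Adj x y → ¬ R.Adj x y → B.Adj x y) →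
      H.IsContained B) : Arrows G (SimpleGraph.pathGraph 3) H := by
  rintro R B rfl -
  by_cases hR : IsMatchingGraph R
  · exact Or.inr (h R B hR fun x y hxy hR => hxy.resolve_left hR)
  · left
    simp only [IsMatchingGraph] at hR
    push Not at hR
    obtain ⟨x, a, b, ha, hb, hab⟩ := hR
    have hax := ha.ne
    have hbx := hb.ne
    refine ⟨⟨⟨![a, x, b], ?_⟩, ?_⟩⟩
    · intro i j hij
      rw [SimpleGraph.pathGraph_adj] at hij
      fin_cases i <;> fin_cases j <;> simp_all [SimpleGraph.adj_comm]
    · intro i j hij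
      fin_cases i <;> fin_cases j <;> simp_all

lemma fan_isContained {V : Type*} {B : SimpleGraph V} {n : ℕ} {u : V} {h : Fin n × Bool → V}
    (hinj : Function.Injective h) (hB : ∀ i, B.Adj (h (i, false)) (h (i, true)))
    (hu : ∀ p, B.Adj u (h p)) : (fan n).IsContained B := by
  refine ⟨⟨⟨fun x => x.elim u h, ?_⟩, ?_⟩⟩
  · rintro (_ | ⟨i, b⟩) (_ | ⟨j, c⟩) hxy
    · exact hxy.elim
    · exact hu _
    · exact (hu _).symm
    · obtain ⟨rfl, hbc⟩ := hxy
      cases b <;> cases c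
      · exact absurd rfl hbc
      · exact hB i
      · exact (hB i).symm
      · exact absurd rfl hbc
  · rintro (_ | p) (_ | q) hxy
    · rfl
    · exact ((hu q).ne hxy).elim
    · exact ((hu p).ne hxy.symm).elim
    · exact congrArg some (hinj hxy)

/-- One spare edge suffices: the edge containing the exceptional vertex v is discarded. -/
lemma fan_isContained_of_card_lt {V I : Type*} [Fintype I] {B : SimpleGraph V} {n : ℕ}
    (hn : n < Fintype.card I) {u v : V} {h : I × Bool → V} (hinj : Function.Injective h)
    (hB : ∀ i, B.Adj (h (i, false)) (h (i, true))) (hu : ∀ p, h p ≠ v → B.Adj u (h p)) :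
    (fan n).IsContained B := by
  classical
  have : Nonempty I := Fintype.card_pos_iff.1 (by omega)
  obtain ⟨i₀, hi₀⟩ : ∃ i₀, ∀ i, i ≠ i₀ → ∀ b, h (i, b) ≠ v := by
    by_cases hv : ∃ p, h p = v
    · obtain ⟨⟨i₀, c⟩, rfl⟩ := hv
      exact ⟨i₀, fun i hi b hb => hi (congrArg Prod.fst (hinj hb))⟩
    · push Not at hv
      exact ⟨Classical.arbitrary I, fun i _ b => hv (i, b)⟩
  obtain ⟨g⟩ : Nonempty (Fin n ↪ {i // i ≠ i₀}) := by
    apply Function.Embedding.nonempty_of_card_le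
    simp only [Fintype.card_fin, ne_eq, Fintype.card_subtype_compl, Fintype.card_unique]
    omega
  refine fan_isContained (u := u) (h := fun p => h ((g p.1).1, p.2)) ?_ (fun i => hB _)
    (fun p => hu _ (hi₀ _ (g p.1).2 _))
  rintro ⟨i, b⟩ ⟨j, c⟩ hij
  have := hinj hij
  simp only [Prod.mk.injEq] at this
  rw [g.injective (Subtype.ext this.1), this.2]

lemma mem_arrowingSizes {V₁ V₂ W : Type*} {G₁ : SimpleGraph V₁} {G₂ : SimpleGraph V₂} [Fintype W]
    {G : SimpleGraph W} (hG : ∀ v, ∃ w, G.Adj v w) (hpos : 0 < G.edgeSet.ncard)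
    (h : Arrows G G₁ G₂) : G.edgeSet.ncard ∈ arrowingSizes G₁ G₂ := by
  let e := Fintype.equivFin W
  refine ⟨hpos, Fintype.card W, G.comap e.symm, fun v => ?_, ?_, fun R B hRB hdisj => ?_⟩
  · obtain ⟨w, hw⟩ := hG (e.symm v)
    exact ⟨e w, by simpa using hw⟩
  · exact Nat.card_congr (SimpleGraph.Iso.comap e.symm G).mapEdgeSet
  · have hR := (SimpleGraph.Iso.comap e R).isContained
    have hB := (SimpleGraph.Iso.comap e B).isContained
    refine (h (R.comap e) (B.comap e) ?_ ?_).imp (fun h => h.trans hR) (fun h => h.trans hB)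
    · ext x y
      have := congrArg (fun H => H.Adj (e x) (e y)) hRB
      simpa using this
    · rw [SimpleGraph.disjoint_left] at hdisj ⊢
      exact fun x y hx hy => hdisj _ _ hx hy

/-- The join of a vertex with `q` disjoint cycles of length four and `p` disjoint paths on three
vertices, given by its list of edges. -/
def coneEdge (q p : ℕ) : (Fin q × Fin 4 ⊕ Fin p × Fin 3) ⊕ (Fin q × Fin 4 ⊕ Fin p × Bool) →
    Sym2 (Option (Fin q × Fin 4 ⊕ Fin p × Fin 3))
  | Sum.inl w => s(none, some w)
  | Sum.inr (Sum.inl (i, j)) => s(some (Sum.inl (i, j)), some (Sum.inl (i, j + 1)))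
  | Sum.inr (Sum.inr (i, b)) =>
      s(some (Sum.inr (i, if b then 1 else 0)), some (Sum.inr (i, if b then 2 else 1)))

/-- The join of a vertex with `q` disjoint cycles of length four and `p` disjoint paths on three
vertices. -/
def cone (q p : ℕ) : SimpleGraph (Option (Fin q × Fin 4 ⊕ Fin p × Fin 3)) :=
  SimpleGraph.fromEdgeSet (Set.range (coneEdge q p))

/-- An inequality is enough, since the lower bound forces equality in the end. -/
lemma ncard_edgeSet_cone_le (q p : ℕ) : (cone q p).edgeSet.ncard ≤ 8 * q + 5 * p := by
  have h1 : (cone q p).edgeSet ⊆ Set.range (coneEdge q p) := by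
    rw [cone, SimpleGraph.edgeSet_fromEdgeSet]
    exact Set.sdiff_subset
  refine (Set.ncard_le_ncard h1 (Set.toFinite _)).trans ?_
  rw [← Set.image_univ]
  refine (Set.ncard_image_le (Set.toFinite _)).trans (le_of_eq ?_)
  simp [Set.ncard_univ]
  ring

lemma cone_adj_none {q p : ℕ} (w) : (cone q p).Adj none (some w) := by
  rw [cone, SimpleGraph.fromEdgeSet_adj]
  exact ⟨⟨Sum.inl w, rfl⟩, by simp⟩

lemma cone_adj_cycle {q p : ℕ} (i : Fin q) (j : Fin 4) :
    (cone q p).Adj (some (Sum.inl (i, j))) (some (Sum.inl (i, j + 1))) := by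
  rw [cone, SimpleGraph.fromEdgeSet_adj]
  exact ⟨⟨Sum.inr (Sum.inl (i, j)), rfl⟩, by simp⟩

lemma cone_adj_path {q p : ℕ} (i : Fin p) (b : Bool) :
    (cone q p).Adj (some (Sum.inr (i, if b then 1 else 0)))
      (some (Sum.inr (i, if b then 2 else 1))) := by
  rw [cone, SimpleGraph.fromEdgeSet_adj]
  exact ⟨⟨Sum.inr (Sum.inr (i, b)), rfl⟩, by cases b <;> simp⟩

lemma arrows_cone {q p n : ℕ} (hn : n < 2 * q + p) :
    Arrows (cone q p) (SimpleGraph.pathGraph 3) (fan n) := by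
  refine arrows_of_forall_matching fun R B hR hB => ?_
  have hcycle : ∀ i : Fin q, ∃ k : Fin 4, ∀ b : Bool,
      B.Adj (some (Sum.inl (i, k + if b then 2 else 0)))
        (some (Sum.inl (i, (k + if b then 2 else 0) + 1))) := by
    intro i
    by_contra! hcon
    have key : ∀ k : Fin 4, R.Adj (some (Sum.inl (i, k))) (some (Sum.inl (i, k + 1))) ∨
        R.Adj (some (Sum.inl (i, k + 2))) (some (Sum.inl (i, k + 3))) := by
      intro k
      obtain ⟨b, hb⟩ := hcon k
      have h1 := not_imp_comm.1 (hB _ _ (cone_adj_cycle i _)) hb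
      cases b
      · exact Or.inl (by simpa using h1)
      · exact Or.inr (by simpa [add_assoc] using h1)
    have step : ∀ j : Fin 4, R.Adj (some (Sum.inl (i, j))) (some (Sum.inl (i, j + 1))) →
        R.Adj (some (Sum.inl (i, j + 1))) (some (Sum.inl (i, j + 2))) → False := by
      intro j h1 h2
      have := hR h1.symm h2
      simp at this
    -- A red edge in each of the two perfect matchings of the 4-cycle would give two red edges
    -- sharing a vertex.
    rcases key 0 with h0 | h0 <;> rcases key 1 with h1 | h1
    · exact step 0 h0 h1
    · exact step 3 h1 h0
    · exact step 1 h1 h0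
    · exact step 2 h0 h1
  have hpath : ∀ i : Fin p, ∃ b : Bool, B.Adj (some (Sum.inr (i, if b then 1 else 0)))
      (some (Sum.inr (i, if b then 2 else 1))) := by
    intro i
    by_contra! hcon
    have h1 := not_imp_comm.1 (hB _ _ (cone_adj_path i true)) (hcon true)
    have h2 := not_imp_comm.1 (hB _ _ (cone_adj_path i false)) (hcon false)
    have := hR h1 h2.symm
    simp at this
  choose k hk using hcycle
  choose d hd using hpath
  obtain ⟨v, hv⟩ : ∃ v, ∀ w, w ≠ v → ¬ R.Adj none w := by
    by_cases h : ∃ v, R.Adj none v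
    · obtain ⟨v, hv⟩ := h
      exact ⟨v, fun w hw h => hw (hR h hv)⟩
    · exact ⟨none, fun w _ hw => h ⟨w, hw⟩⟩
  let g : (Fin q × Bool ⊕ Fin p) × Bool → Fin q × Fin 4 ⊕ Fin p × Fin 3
    | (Sum.inl (i, b), t) =>
        Sum.inl (i, if t then (k i + if b then 2 else 0) + 1 else k i + if b then 2 else 0)
    | (Sum.inr i, t) =>
        Sum.inr (i, if t then if d i then 2 else 1 else if d i then 1 else 0)
  have h4 : ∀ (k : Fin 4) (b c s t : Bool),
      (if s then (k + if b then 2 else 0) + 1 else k + if b then 2 else 0) =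
      (if t then (k + if c then 2 else 0) + 1 else k + if c then 2 else 0) → b = c ∧ s = t := by
    decide
  have h3 : ∀ d s t : Bool, (if s then if d then (2 : Fin 3) else 1 else if d then 1 else 0) =
      (if t then if d then 2 else 1 else if d then 1 else 0) → s = t := by
    decide
  have hg : Function.Injective g := by
    rintro ⟨⟨i, b⟩ | i, s⟩ ⟨⟨j, c⟩ | j, t⟩ hij
    · simp only [g, Sum.inl.injEq, Prod.mk.injEq] at hij
      obtain ⟨rfl, hij⟩ := hij
      obtain ⟨rfl, rfl⟩ := h4 _ _ _ _ _ hij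
      rfl
    · simp [g] at hij
    · simp [g] at hij
    · simp only [g, Sum.inr.injEq, Prod.mk.injEq] at hij
      obtain ⟨rfl, hij⟩ := hij
      obtain rfl := h3 _ _ _ hij
      rfl
  refine fan_isContained_of_card_lt (I := Fin q × Bool ⊕ Fin p) (u := none) (v := v)
    (h := fun x => some (g x)) ?_ (fun _ _ hxy => hg (Option.some_injective _ hxy)) ?_
    (fun x hx => hB _ _ (cone_adj_none _) (hv _ hx))
  · simp only [Fintype.card_sum, Fintype.card_prod, Fintype.card_fin, Fintype.card_bool]
    omega
  · rintro (⟨i, b⟩ | i)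
    · exact hk i b
    · exact hd i

lemma exists_mem_arrowingSizes_le {q p n : ℕ} (hn : n < 2 * q + p) :
    ∃ m ∈ arrowingSizes (SimpleGraph.pathGraph 3) (fan n), m ≤ 8 * q + 5 * p := by
  refine ⟨_, mem_arrowingSizes ?_ ?_ (arrows_cone hn), ncard_edgeSet_cone_le q p⟩
  · rintro (_ | w)
    · obtain hq | hp : 0 < q ∨ 0 < p := by omega
      · exact ⟨_, cone_adj_none (Sum.inl (⟨0, hq⟩, 0))⟩
      · exact ⟨_, cone_adj_none (Sum.inr (⟨0, hp⟩, 0))⟩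
    · exact ⟨_, (cone_adj_none w).symm⟩
  · rw [Set.ncard_pos (Set.toFinite _)]
    obtain hq | hp : 0 < q ∨ 0 < p := by omega
    · exact ⟨_, (SimpleGraph.mem_edgeSet _).2 (cone_adj_none (Sum.inl (⟨0, hq⟩, 0)))⟩
    · exact ⟨_, (SimpleGraph.mem_edgeSet _).2 (cone_adj_none (Sum.inr (⟨0, hp⟩, 0)))⟩

/-- As 5 is odd, the red matching misses a vertex u. The other four span a complete graph, which
keeps a perfect matching once a matching is deleted. -/
lemma arrows_top_five : Arrows (⊤ : SimpleGraph (Fin 5)) (SimpleGraph.pathGraph 3) (fan 2) := by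
  refine arrows_of_forall_matching fun R B hR hB => ?_
  obtain ⟨u, hu⟩ : ∃ u, ∀ w, ¬ R.Adj u w := by
    by_contra! hcon
    have h1 : ∀ x ∈ Finset.univ, inDeg R Finset.univ x = 1 := by
      intro x _
      obtain ⟨y, hy⟩ := hcon x
      refine Finset.card_eq_one.2 ⟨y, ?_⟩
      ext z
      simp only [Finset.mem_filter, Finset.mem_univ, true_and, Finset.mem_singleton]
      exact ⟨fun hz => hR hz hy, fun hz => hz ▸ hy⟩
    have h2 := darts_univ R
    rw [darts, Finset.sum_congr rfl h1] at h2
    simp at h2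
    omega
  have hstar : ∀ j : Fin 5, j ≠ 0 → B.Adj u (u + j) := fun j hj =>
    hB _ _ (by simpa [eq_comm] using hj) (hu _)
  have hedge : ∀ i j : Fin 5, i ≠ j → ¬ R.Adj (u + i) (u + j) → B.Adj (u + i) (u + j) :=
    fun i j hij => hB _ _ (by simpa using hij)
  have hR' : ∀ i j k : Fin 5, j ≠ k → R.Adj (u + i) (u + j) → ¬ R.Adj (u + i) (u + k) :=
    fun i j k hjk h1 h2 => hjk (add_left_cancel (hR h1 h2))
  by_cases h : R.Adj (u + 1) (u + 2) ∨ R.Adj (u + 3) (u + 4)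
  · have h13 : ¬ R.Adj (u + 1) (u + 3) := by
      rcases h with h | h
      · exact hR' _ _ _ (by decide) h
      · exact fun h' => hR' _ _ _ (by decide) h h'.symm
    have h24 : ¬ R.Adj (u + 2) (u + 4) := by
      rcases h with h | h
      · exact hR' _ _ _ (by decide) h.symm
      · exact fun h' => hR' _ _ _ (by decide) h.symm h'.symm
    refine fan_isContained (u := u)
      (h := fun x => u + if x.1 = 0 then if x.2 then 3 else 1 else if x.2 then 4 else 2) ?_ ?_
      fun x => hstar _ ?_
    · refine (add_right_injective u).comp ?_
      decide
    · intro i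
      fin_cases i
      · exact hedge 1 3 (by decide) h13
      · exact hedge 2 4 (by decide) h24
    · revert x; decide
  · push Not at h
    refine fan_isContained (u := u)
      (h := fun x => u + if x.1 = 0 then if x.2 then 2 else 1 else if x.2 then 4 else 3) ?_ ?_
      fun x => hstar _ ?_
    · refine (add_right_injective u).comp ?_
      decide
    · intro i
      fin_cases i
      · exact hedge 1 2 (by decide) h.1
      · exact hedge 3 4 (by decide) h.2
    · revert x; decide

lemma ten_mem_arrowingSizes : 10 ∈ arrowingSizes (SimpleGraph.pathGraph 3) (fan 2) := by
  have h : (⊤ : SimpleGraph (Fin 5)).edgeSet.ncard = 10 := by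
    rw [Set.ncard_eq_toFinset_card', ← SimpleGraph.edgeFinset,
      SimpleGraph.card_edgeFinset_top_eq_card_choose_two]
    rfl
  rw [← h]
  refine mem_arrowingSizes (fun v => ⟨v + 1, by simp⟩) (by omega) arrows_top_five

/-! ### Combining the bounds -/

lemma le_of_mem_arrowingSizes {n m : ℕ} (hn : 0 < n)
    (hm : m ∈ arrowingSizes (SimpleGraph.pathGraph 3) (fan n)) :
    (if n = 2 then 10 else if Odd n then 4 * n + 4 else 4 * n + 5) ≤ m := by
  obtain ⟨-, k, G, -, rfl, hG⟩ := hm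
  have hF := fanRobust_of_arrows hG
  obtain rfl | hn2 : n = 1 ∨ 2 ≤ n := by omega
  · simpa using hF.eight_le
  · have h := hF.darts_ge hn2
    rw [darts_univ] at h
    split_ifs with h2 hodd
    · omega
    · obtain ⟨j, rfl⟩ := hodd
      omega
    · rw [Nat.not_odd_iff_even] at hodd
      have : 4 ≤ n := by
        obtain ⟨j, rfl⟩ := hodd
        omega
      rcases h with h | h
      · have := h.2 this hodd
        omega
      · omega

end FanRamsey

theorem theorem1p4 (n : ℕ) (hn : 0 < n) :
    IsSizeRamseyNumber (SimpleGraph.pathGraph 3) (fan n)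
      (if n = 2 then 10 else if Odd n then 4 * n + 4 else 4 * n + 5) := by
  refine ⟨?_, fun m hm => FanRamsey.le_of_mem_arrowingSizes hn hm⟩
  obtain ⟨m, hm, hle⟩ : ∃ m ∈ arrowingSizes (SimpleGraph.pathGraph 3) (fan n),
      m ≤ if n = 2 then 10 else if Odd n then 4 * n + 4 else 4 * n + 5 := by
    split_ifs with h2 hodd
    · subst h2
      exact ⟨10, FanRamsey.ten_mem_arrowingSizes, le_rfl⟩
    · obtain ⟨k, rfl⟩ := hodd
      obtain ⟨m, hm, hle⟩ := FanRamsey.exists_mem_arrowingSizes_le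
        (q := k + 1) (p := 0) (n := 2 * k + 1) (by omega)
      exact ⟨m, hm, by omega⟩
    · obtain ⟨k, rfl⟩ := Nat.not_odd_iff_even.1 hodd
      obtain ⟨m, hm, hle⟩ := FanRamsey.exists_mem_arrowingSizes_le
        (q := k) (p := 1) (n := k + k) (by omega)
      exact ⟨m, hm, by omega⟩
  rwa [← le_antisymm hle (FanRamsey.le_of_mem_arrowingSizes hn hm)]
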